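/- Let $Q\in\mathbb R^{n\times n}$ be symmetric positive semidefinite, $\mathbf c\in\mathbb R^n$, $\mathbf a_1,\dots,\mathbf a_m\in\mathbb R^n$, $\mathcal B\subseteq[n]$, $U_i\in\mathbb R$ for $i\in[n]\setminus\mathcal B$, and let $b_1,\dots,b_m:\mathbb R^d\to\mathbb R$ be differentiable. For $\mathbf u\in\mathbb R^d$ let $\mathcal P^{\mathrm{SDP\text{-}bd}}(\mathbf u)$ be the problem of minimising $\operatorname{Tr}(Q^\top X)+\mathbf c^\top\mathbf x$ over $\mathbf x\in\mathbb R^n$, $X\in\mathbb R^{n\times n}$ subject to $\mathbf a_j^\top\mathbf x=b_j(\mathbf u)$ and $\operatorname{Tr}(\mathbf a_j\mathbf a_j^\top X)=b_j(\mathbf u)^2$ for all $j\in[m]$, $x_i=X_{ii}$ for $i\in\mathcal B$, $X_{ii}\le U_i^2$ for $i\in[n]\setminus\mathcal B$, and $$Y=\begin{pmatrix}1&\mathbf x^\top\\ \mathbf x&X\end{pmatrix}\succeq 0,\qquad Y\ge 0\ \text{entrywise}.$$ Let $V(\mathbf u)\in(-\infty,+\infty]$ be its optimal value ($+\infty$ if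 it is infeasible). With $$C=\begin{pmatrix}0&\tfrac12\mathbf c^\top\\ \tfrac12\mathbf c&Q\end{pmatrix},\quad A_j=\begin{pmatrix}0&\tfrac12\mathbf a_j^\top\\ \tfrac12\mathbf a_j&0\end{pmatrix},\quad \hat A_j=\begin{pmatrix}0&0\\0&\mathbf a_j\mathbf a_j^\top\end{pmatrix},$$ $$B_i=\begin{pmatrix}0&\tfrac12\mathbf e_i^\top\\ \tfrac12\mathbf e_i&-\mathbf e_i\mathbf e_i^\top\end{pmatrix},\quad G_i=\begin{pmatrix}0&0\\0&\mathbf e_i\mathbf e_i^\top\end{pmatrix},\quad H=\begin{pmatrix}1&0\\0&0\end{pmatrix},$$ the dual feasible set $F^d$ consists of all $\Psi=(\gamma,\omega,\phi,\kappa,\mu,\Omega,\Theta)$ with $\phi\le 0$, $\Theta\ge 0$ entrywise, $\Omega\succeq 0$ and $$C-\sum_{j}\gamma_jA_j-\sum_j\omega_j\hat A_j-\sum_{i\in\mathcal B}\kappa_iB_i-\sum_{i\notin\mathcal B}\phi_iG_i-\mu H=\Theta+\Omega ,$$ and the dual objective is $$f^d(\Psi,\mathbf u)=\sum_{j=1}^m\bigl(\gamma_jb_j(\mathbf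 u)+\omega_jb_j(\mathbf u)^2\bigr)+\mu+\sum_{i\notin\mathcal B}U_i^2\phi_i .$$ Let $\mathcal U\subseteq\mathbb R^d$ be a set such that $\mathcal P^{\mathrm{SDP\text{-}bd}}(\mathbf u)$ is feasible for every $\mathbf u\in\mathcal U$. Then for every $\mathbf u\in\mathcal U$: 1. the minimum defining $V(\mathbf u)$ is attained, and $V(\mathbf u)=\sup_{\Psi\in F^d}f^d(\Psi,\mathbf u)$; 2. if $\Psi^*$ is an optimal solution of the dual problem at $\mathbf u$, then $V(\mathbf u)=\max_{\Psi\in F^d}f^d(\Psi,\mathbf u)=f^d(\Psi^*,\mathbf u)$; and if moreover $V$ is differentiable at $\mathbf u$ (that is, finite in a neighbourhood of $\mathbf u$ and differentiable there at $\mathbf u$), then $f^d(\Psi^*,\cdot)$ is differentiable at $\mathbf u$ and $\nabla V(\mathbf u)=\nabla_{\mathbf u}f^d(\Psi^*,\mathbf u)$. -/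

import Mathlib

open scoped Matrix Topology

noncomputable section

namespace SDPEnvelope

/-- Data of a mixed-binary quadratic problem in `n` nonnegative variables with `m` linear equality
constraints: minimise `xᵀ Q x + cᵀ x` subject to `a jᵀ x = b j` and `x i ∈ {0, 1}` for `i ∈ B`.
`U i` is the bound imposed on the continuous variable `x i`, `i ∉ B`; its values on `B` play no
role. The right-hand sides `b` are kept separate, since they carry the parameter. -/
structure Data (n m : ℕ) where
  Q : Matrix (Fin n) (Fin n) ℝ
  c : Fin n → ℝ
  a : Fin m → Fin n → ℝ
  B : Finset (Fin n)
  U : Fin n → ℝ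

/-- Symmetric matrices of order `n + 1` are indexed by `Unit ⊕ Fin n`; this is the block matrix
`[[s, vᵀ], [v, W]]`. -/
def block {n : ℕ} (s : ℝ) (v : Fin n → ℝ) (W : Matrix (Fin n) (Fin n) ℝ) :
    Matrix (Unit ⊕ Fin n) (Unit ⊕ Fin n) ℝ :=
  Matrix.fromBlocks (Matrix.of fun _ _ => s) (Matrix.replicateRow Unit v)
    (Matrix.replicateCol Unit v) W

namespace Data

variable {n m : ℕ} (P : Data n m)

/-! ### The primal problem -/

/-- `(x, X)` is feasible for the strengthened semidefinite relaxation with right-hand side `b`. -/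
structure IsPrimalFeasible (b : Fin m → ℝ) (x : Fin n → ℝ) (X : Matrix (Fin n) (Fin n) ℝ) :
    Prop where
  linear : ∀ j, P.a j ⬝ᵥ x = b j
  lifted : ∀ j, (Matrix.vecMulVec (P.a j) (P.a j) * X).trace = b j ^ 2
  binary : ∀ i ∈ P.B, x i = X i i
  bound : ∀ i ∉ P.B, X i i ≤ P.U i ^ 2
  posSemidef : (block 1 x X).PosSemidef
  nonneg : ∀ p q, 0 ≤ block 1 x X p q

/-- Feasible region of the strengthened semidefinite relaxation. -/
def primalFeas (b : Fin m → ℝ) : Set ((Fin n → ℝ) × Matrix (Fin n) (Fin n) ℝ) :=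
  {z | P.IsPrimalFeasible b z.1 z.2}

/-- Primal objective `Tr(Qᵀ X) + cᵀ x`. -/
def primalObj (z : (Fin n → ℝ) × Matrix (Fin n) (Fin n) ℝ) : ℝ :=
  (P.Qᵀ * z.2).trace + P.c ⬝ᵥ z.1

/-- Optimal value of the primal problem, with the usual value `+∞` if it is infeasible. -/
def primalValue (b : Fin m → ℝ) : EReal :=
  ⨅ z ∈ P.primalFeas b, (P.primalObj z : EReal)

/-! ### The dual problem -/

/-- Dual variables: `γ` for the linear constraints, `ω` for the lifted ones, `φ` for the bounds,
`κ` for the binary constraints, `μ` for the constraint that the top left entry of `Y` is `1`,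
`Ω` for positive semidefiniteness and `Θ` for entrywise nonnegativity of `Y`. -/
structure DualVar where
  γ : Fin m → ℝ
  ω : Fin m → ℝ
  φ : {i // i ∉ P.B} → ℝ
  κ : {i // i ∈ P.B} → ℝ
  μ : ℝ
  Ω : Matrix (Unit ⊕ Fin n) (Unit ⊕ Fin n) ℝ
  Θ : Matrix (Unit ⊕ Fin n) (Unit ⊕ Fin n) ℝ

/-- Objective matrix: `Tr(C Y) = Tr(Qᵀ X) + cᵀ x`. -/
def matC : Matrix (Unit ⊕ Fin n) (Unit ⊕ Fin n) ℝ := block 0 ((1 / 2 : ℝ) • P.c) P.Q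

/-- `Tr(A j Y) = a jᵀ x`. -/
def matA (j : Fin m) : Matrix (Unit ⊕ Fin n) (Unit ⊕ Fin n) ℝ :=
  block 0 ((1 / 2 : ℝ) • P.a j) 0

/-- `Tr(Â j Y) = Tr(a j (a j)ᵀ X)`. -/
def matAhat (j : Fin m) : Matrix (Unit ⊕ Fin n) (Unit ⊕ Fin n) ℝ :=
  block 0 0 (Matrix.vecMulVec (P.a j) (P.a j))

end Data

/-- `Tr(B i Y) = x i - X i i`. -/
def matB {n : ℕ} (i : Fin n) : Matrix (Unit ⊕ Fin n) (Unit ⊕ Fin n) ℝ :=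
  block 0 ((1 / 2 : ℝ) • Pi.single i 1) (-Matrix.single i i 1)

/-- `Tr(G i Y) = X i i`. -/
def matG {n : ℕ} (i : Fin n) : Matrix (Unit ⊕ Fin n) (Unit ⊕ Fin n) ℝ :=
  block 0 0 (Matrix.single i i 1)

/-- `Tr(H Y)` is the top left entry of `Y`. -/
def matH (n : ℕ) : Matrix (Unit ⊕ Fin n) (Unit ⊕ Fin n) ℝ := block 1 0 0

namespace Data

variable {n m : ℕ} (P : Data n m)

/-- Dual feasibility. It does not involve the right-hand side `b`. -/
structure IsDualFeasible (Ψ : P.DualVar) : Prop where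
  eq : P.matC - ∑ j, Ψ.γ j • P.matA j - ∑ j, Ψ.ω j • P.matAhat j
      - ∑ i, Ψ.κ i • matB i.1 - ∑ i, Ψ.φ i • matG i.1 - Ψ.μ • matH n = Ψ.Θ + Ψ.Ω
  φ_nonpos : ∀ i, Ψ.φ i ≤ 0
  Θ_nonneg : ∀ p q, 0 ≤ Ψ.Θ p q
  Ω_posSemidef : Ψ.Ω.PosSemidef

/-- Feasible region of the dual problem. -/
def dualFeas : Set P.DualVar := {Ψ | P.IsDualFeasible Ψ}

/-- Dual objective `f^d` at the right-hand side `b`. -/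
def dualObj (Ψ : P.DualVar) (b : Fin m → ℝ) : ℝ :=
  ∑ j, (Ψ.γ j * b j + Ψ.ω j * b j ^ 2) + Ψ.μ + ∑ i, P.U i.1 ^ 2 * Ψ.φ i

/-- Set of optimal solutions of the dual problem at the right-hand side `b`. -/
def dualOpt (b : Fin m → ℝ) : Set P.DualVar :=
  {Ψ | Ψ ∈ P.dualFeas ∧ ∀ Ψ' ∈ P.dualFeas, P.dualObj Ψ' b ≤ P.dualObj Ψ b}

end Data

/-- Differentiability at `u` of an extended-real-valued function on `ℝᵈ`: it is finite near `u`
and its real-valued version is differentiable at `u`. -/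
def ERealDifferentiableAt {d : ℕ} (V : EuclideanSpace ℝ (Fin d) → EReal)
    (u : EuclideanSpace ℝ (Fin d)) : Prop :=
  (∀ᶠ w in 𝓝 u, V w ≠ ⊤ ∧ V w ≠ ⊥) ∧ DifferentiableAt ℝ (fun w => (V w).toReal) u

end SDPEnvelope

end

noncomputable section

namespace SDPEnvelope

/-! The constraints bound the diagonal of `Y`, and positive semidefiniteness then bounds every
entry. So the primal feasible set is compact and the minimum is attained.

The same boundedness gives a zero duality gap without a Slater condition. Write the primal in conic
form with variables `(Y, N, s, t)`: `Y` semidefinite, `N` a nonnegative copy of `Y`, `s` and `t`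
slacks of the bounds and of "objective at most `r`". If `r` is strictly below every primal objective
value, the image of this cone meets the ray spanned by the right-hand side only through the apex
(`eq_zero_of_constraintMap_eq_smul`). The cone has a compact base, so strict separation yields
multipliers that are positive on the whole cone minus its apex. In particular the objective
multiplier is positive, and dividing by it produces a dual feasible point of value at least `r`.

For the gradient, the dual feasible set does not depend on `u`. Hence a fixed optimal `Ψ` gives a
function that lies below `V` everywhere by weak duality and touches it at `u`. Their difference has
a local minimum there, so the derivatives agree. -/

/-- Separation of a ray from the linear image of a cone with compact base which meets that ray only
at the image of the apex. -/
theorem exists_pos_of_cone_disjoint_ray {Z ι : Type*} [AddCommGroup Z] [Module ℝ Z]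
    [TopologicalSpace Z] [Fintype ι] (C : ConvexCone ℝ Z) (τ : Z →ₗ[ℝ] ℝ)
    (hτ : ∀ z ∈ C, z ≠ 0 → 0 < τ z) (hK : IsCompact {z | z ∈ C ∧ τ z = 1})
    (L : Z →ₗ[ℝ] (ι → ℝ)) (hL : Continuous L) (p : ι → ℝ)
    (h : ∀ z ∈ C, ∀ t : ℝ, 0 ≤ t → L z = t • p → z = 0) :
    ∃ y : ι → ℝ, (∀ z ∈ C, z ≠ 0 → 0 < y ⬝ᵥ L z) ∧ y ⬝ᵥ p ≤ 0 := by
  classical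
  set K : Set Z := {z | z ∈ C ∧ τ z = 1}
  have hconv : Convex ℝ K := by
    refine C.convex.inter ?_
    intro x hx y hy a b _ _ hab
    have hx : τ x = 1 := hx
    have hy : τ y = 1 := hy
    show τ (a • x + b • y) = 1
    simp [hx, hy, hab]
  have hdisj : Disjoint (L '' K) ((fun t : ℝ => t • p) '' Set.Ici 0) := by
    rw [Set.disjoint_left]
    rintro _ ⟨z, hz, rfl⟩ ⟨t, ht, htz⟩
    have h0 := h z hz.1 t ht htz.symm
    have h1 := hz.2
    rw [h0, map_zero] at h1
    exact zero_ne_one h1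
  have hray_conv : Convex ℝ ((fun t : ℝ => t • p) '' Set.Ici 0) :=
    (convex_Ici (0 : ℝ)).linear_image (LinearMap.toSpanSingleton ℝ (ι → ℝ) p)
  have hray_closed : IsClosed ((fun t : ℝ => t • p) '' Set.Ici 0) :=
    isClosedMap_smul_left p _ isClosed_Ici
  obtain ⟨f, u, v, hfu, huv, hv⟩ := geometric_hahn_banach_compact_closed
    (hconv.linear_image L) (hK.image hL) hray_conv hray_closed hdisj
  have hv0 : v < 0 := by simpa using hv _ ⟨0, by simp, rfl⟩
  have hfp : 0 ≤ f p := by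
    by_contra hneg
    push Not at hneg
    -- At this point of the ray `f` takes the value `v` exactly, contradicting the strict bound.
    have := hv _ ⟨v / f p, (div_pos_of_neg_of_neg hv0 hneg).le, rfl⟩
    simp only [map_smul, smul_eq_mul] at this
    rw [div_mul_cancel₀ _ hneg.ne] at this
    exact lt_irrefl _ this
  have hf (x : ι → ℝ) : (fun i => -f (Pi.single i 1)) ⬝ᵥ x = -f x := by
    conv_rhs => rw [pi_eq_sum_univ' x]
    simp only [map_sum, map_smul, smul_eq_mul, dotProduct, ← Finset.sum_neg_distrib]
    exact Finset.sum_congr rfl fun i _ => by ring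
  refine ⟨fun i => -f (Pi.single i 1), fun z hz hz0 => ?_, by rw [hf]; linarith⟩
  have hpos := hτ z hz hz0
  have hmem : (τ z)⁻¹ • z ∈ K :=
    ⟨C.smul_mem (inv_pos.2 hpos) hz, by simp [hpos.ne']⟩
  have := hfu _ ⟨_, hmem, rfl⟩
  simp only [map_smul, smul_eq_mul] at this
  rw [hf]
  have h2 : (τ z)⁻¹ * f (L z) < 0 := by linarith
  exact neg_pos.2 (neg_of_mul_neg_right h2 (inv_pos.2 hpos).le)

/-! ### Positive semidefinite matrices: entry bounds, trace pairing, compactness. -/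

section PosSemidef

variable {I : Type*} [Fintype I]

theorem isClosed_setOf_posSemidef : IsClosed {Y : Matrix I I ℝ | Y.PosSemidef} := by
  simp only [Matrix.posSemidef_iff_dotProduct_mulVec, Set.ofPred_and, Set.ofPred_forall]
  refine IsClosed.inter (isClosed_eq (by fun_prop) continuous_id)
    (isClosed_iInter fun x => isClosed_le continuous_const (by fun_prop))

/-- The quadratic form along `e_p + s e_q` is a nonnegative quadratic in `s`, so its discriminant is
nonpositive. -/
theorem sq_apply_le_of_posSemidef {Y : Matrix I I ℝ} (hY : Y.PosSemidef) (p q : I) :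
    Y p q ^ 2 ≤ Y p p * Y q q := by
  classical
  have hsymm : Y q p = Y p q := by simpa using hY.isHermitian.apply p q
  have key (s : ℝ) : 0 ≤ Y q q * (s * s) + 2 * Y p q * s + Y p p := by
    have := hY.dotProduct_mulVec_nonneg (Pi.single p 1 + s • Pi.single q 1)
    simp [Matrix.mulVec_add, Matrix.mulVec_smul, add_dotProduct, hsymm] at this
    linarith
  have := discrim_le_zero key
  rw [discrim] at this
  linarith

theorem abs_apply_le_of_posSemidef {Y : Matrix I I ℝ} (hY : Y.PosSemidef) {R : ℝ}
    (hR : ∀ p, Y p p ≤ R) (p q : I) : |Y p q| ≤ R := by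
  have h0 : 0 ≤ R := hY.diag_nonneg.trans (hR p)
  refine abs_le_of_sq_le_sq ((sq_apply_le_of_posSemidef hY p q).trans ?_) h0
  rw [sq]
  exact mul_le_mul (hR p) (hR q) hY.diag_nonneg h0

open scoped MatrixOrder in
theorem trace_mul_nonneg_of_posSemidef {A Y : Matrix I I ℝ} (hA : A.PosSemidef)
    (hY : Y.PosSemidef) : 0 ≤ (A * Y).trace := by
  classical
  obtain ⟨B, rfl⟩ := CStarAlgebra.nonneg_iff_eq_star_mul_self.1 hA.nonneg
  rw [Matrix.star_eq_conjTranspose, Matrix.mul_assoc, Matrix.trace_mul_comm]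
  exact (hY.mul_mul_conjTranspose_same B).trace_nonneg

theorem trace_mul_nonneg_of_nonneg {A Y : Matrix I I ℝ} (hA : ∀ p q, 0 ≤ A p q)
    (hY : ∀ p q, 0 ≤ Y p q) : 0 ≤ (A * Y).trace :=
  Finset.sum_nonneg fun p _ => Finset.sum_nonneg fun q _ => mul_nonneg (hA p q) (hY q p)

theorem trace_mul_vecMulVec_self (A : Matrix I I ℝ) (x : I → ℝ) :
    (A * Matrix.vecMulVec x x).trace = x ⬝ᵥ A *ᵥ x := by
  rw [Matrix.mul_vecMulVec, Matrix.trace_vecMulVec, dotProduct_comm]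

/-- One half of the self-duality of the semidefinite cone, by testing on rank one matrices. Symmetry
is assumed separately because the pairing sees only the symmetric part of `A`. -/
theorem posSemidef_of_trace_mul_nonneg {A : Matrix I I ℝ} (hA : A.IsHermitian)
    (h : ∀ Y : Matrix I I ℝ, Y.PosSemidef → 0 ≤ (A * Y).trace) : A.PosSemidef := by
  refine Matrix.posSemidef_iff_dotProduct_mulVec.2 ⟨hA, fun x => ?_⟩
  have := h _ (Matrix.posSemidef_vecMulVec_self_star x)
  simpa [trace_mul_vecMulVec_self] using this

theorem isCompact_of_posSemidef_of_diag_le {S : Set (Matrix I I ℝ)} (hS : IsClosed S) (R : ℝ)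
    (h : ∀ Y ∈ S, Y.PosSemidef ∧ ∀ p, Y p p ≤ R) : IsCompact S := by
  have hc : IsCompact (Set.univ.pi fun _ : I => Set.univ.pi fun _ : I => Set.Icc (-R) R) :=
    isCompact_univ_pi fun _ => isCompact_univ_pi fun _ => isCompact_Icc
  exact IsCompact.of_isClosed_subset (X := I → I → ℝ) hc hS fun Y hY p _ q _ =>
    abs_le.1 (abs_apply_le_of_posSemidef (h Y hY).1 (h Y hY).2 p q)

end PosSemidef

/-! ### The product cone and its compact base. -/

/-- The product of the cones of positive semidefinite matrices, of entrywise nonnegative matrices,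
of nonnegative vectors and of nonnegative reals. -/
def productCone (I σ : Type*) [Fintype I] :
    ConvexCone ℝ (Matrix I I ℝ × Matrix I I ℝ × (σ → ℝ) × ℝ) where
  carrier := {z | z.1.PosSemidef ∧ (∀ p q, 0 ≤ z.2.1 p q) ∧ (∀ i, 0 ≤ z.2.2.1 i) ∧ 0 ≤ z.2.2.2}
  smul_mem' := fun _ hc _ hz => ⟨hz.1.smul hc.le, fun p q => mul_nonneg hc.le (hz.2.1 p q),
    fun i => mul_nonneg hc.le (hz.2.2.1 i), mul_nonneg hc.le hz.2.2.2⟩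
  add_mem' := fun _ hx _ hy => ⟨hx.1.add hy.1, fun p q => add_nonneg (hx.2.1 p q) (hy.2.1 p q),
    fun i => add_nonneg (hx.2.2.1 i) (hy.2.2.1 i), add_nonneg hx.2.2.2 hy.2.2.2⟩

theorem mem_productCone {I σ : Type*} [Fintype I]
    {z : Matrix I I ℝ × Matrix I I ℝ × (σ → ℝ) × ℝ} :
    z ∈ productCone I σ ↔
      z.1.PosSemidef ∧ (∀ p q, 0 ≤ z.2.1 p q) ∧ (∀ i, 0 ≤ z.2.2.1 i) ∧ 0 ≤ z.2.2.2 :=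
  Iff.rfl

/-- A linear functional which is positive on `productCone` away from the apex. -/
def productConeSum (I σ : Type*) [Fintype I] [Fintype σ] :
    (Matrix I I ℝ × Matrix I I ℝ × (σ → ℝ) × ℝ) →ₗ[ℝ] ℝ where
  toFun z := z.1.trace + ∑ p, ∑ q, z.2.1 p q + ∑ i, z.2.2.1 i + z.2.2.2
  map_add' x y := by
    simp only [Prod.fst_add, Prod.snd_add, Matrix.trace_add, Matrix.add_apply, Pi.add_apply,
      Finset.sum_add_distrib]
    ring
  map_smul' c x := by
    simp only [Prod.smul_fst, Prod.smul_snd, Matrix.trace_smul, Matrix.smul_apply, Pi.smul_apply,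
      smul_eq_mul, ← Finset.mul_sum, RingHom.id_apply]
    ring

section ProductCone

variable {I σ : Type*} [Fintype I] [Fintype σ]

theorem productConeSum_apply (z : Matrix I I ℝ × Matrix I I ℝ × (σ → ℝ) × ℝ) :
    productConeSum I σ z = z.1.trace + ∑ p, ∑ q, z.2.1 p q + ∑ i, z.2.2.1 i + z.2.2.2 := rfl

theorem productConeSum_pos {z : Matrix I I ℝ × Matrix I I ℝ × (σ → ℝ) × ℝ}
    (hz : z ∈ productCone I σ) (h0 : z ≠ 0) : 0 < productConeSum I σ z := by
  obtain ⟨Y, N, s, t⟩ := z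
  obtain ⟨hY, hN, hs, ht⟩ := hz
  simp only at hY hN hs ht
  have hN' : ∀ p, 0 ≤ ∑ q, N p q := fun p => Finset.sum_nonneg fun q _ => hN p q
  have h1 := hY.trace_nonneg
  have h2 : 0 ≤ ∑ p, ∑ q, N p q := Finset.sum_nonneg fun p _ => hN' p
  have h3 : 0 ≤ ∑ i, s i := Finset.sum_nonneg fun i _ => hs i
  rw [productConeSum_apply]
  simp only
  by_contra hle
  push Not at hle
  apply h0
  have e1 : Y = 0 := hY.trace_eq_zero_iff.1 (by linarith)
  have e2 : N = 0 := by
    ext p q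
    have := (Finset.sum_eq_zero_iff_of_nonneg fun p _ => hN' p).1
      (show ∑ p, ∑ q, N p q = 0 by linarith) p (Finset.mem_univ _)
    exact (Finset.sum_eq_zero_iff_of_nonneg fun q _ => hN p q).1 this q (Finset.mem_univ _)
  have e3 : s = 0 := by
    ext i
    exact (Finset.sum_eq_zero_iff_of_nonneg fun i _ => hs i).1
      (show ∑ i, s i = 0 by linarith) i (Finset.mem_univ _)
  have e4 : t = 0 := by linarith
  rw [e1, e2, e3, e4]
  rfl

/-- All four summands of the functional are nonnegative, so each is at most `1`; the trace then
controls the diagonal of `Y`, hence all its entries. -/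
theorem isCompact_productCone_base :
    IsCompact {z | z ∈ productCone I σ ∧ productConeSum I σ z = 1} := by
  have hN : IsCompact (Set.univ.pi fun _ : I => Set.univ.pi fun _ : I => Set.Icc (0 : ℝ) 1) :=
    isCompact_univ_pi fun _ => isCompact_univ_pi fun _ => isCompact_Icc
  have hs : IsCompact (Set.univ.pi fun _ : σ => Set.Icc (0 : ℝ) 1) :=
    isCompact_univ_pi fun _ => isCompact_Icc
  have hY : IsCompact {Y : Matrix I I ℝ | Y.PosSemidef ∧ ∀ p, Y p p ≤ 1} := by
    refine isCompact_of_posSemidef_of_diag_le ?_ 1 fun _ h => h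
    simp only [Set.ofPred_and, Set.ofPred_forall]
    exact isClosed_setOf_posSemidef.inter
      (isClosed_iInter fun p => isClosed_le (by fun_prop) continuous_const)
  have hcont : Continuous (productConeSum I σ) := by
    show Continuous fun z : Matrix I I ℝ × Matrix I I ℝ × (σ → ℝ) × ℝ =>
      z.1.trace + ∑ p, ∑ q, z.2.1 p q + ∑ i, z.2.2.1 i + z.2.2.2
    fun_prop
  refine IsCompact.of_isClosed_subset
    (hY.prod (IsCompact.prod (X := Matrix I I ℝ) hN (hs.prod (isCompact_Icc (a := 0) (b := 1)))))
    ?_ ?_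
  · simp only [mem_productCone, Set.ofPred_and, Set.ofPred_forall]
    refine IsClosed.inter ((isClosed_setOf_posSemidef.preimage continuous_fst).inter
      (IsClosed.inter ?_ (IsClosed.inter ?_ (isClosed_le continuous_const (by fun_prop)))))
      (isClosed_eq hcont continuous_const)
    · exact isClosed_iInter fun p => isClosed_iInter fun q =>
        isClosed_le continuous_const (by fun_prop)
    · exact isClosed_iInter fun i => isClosed_le continuous_const (by fun_prop)
  · rintro ⟨Y, N, s, t⟩ ⟨⟨hY, hN, hs, ht⟩, h1⟩
    simp only at hY hN hs ht
    rw [productConeSum_apply] at h1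
    simp only at h1
    have hd : ∀ p, Y p p ≤ Y.trace := fun p =>
      Finset.single_le_sum (f := fun p => Y p p) (fun p _ => hY.diag_nonneg) (Finset.mem_univ p)
    have hN' : ∀ p, 0 ≤ ∑ q, N p q := fun p => Finset.sum_nonneg fun q _ => hN p q
    have hNle : ∀ p q, N p q ≤ ∑ p, ∑ q, N p q := fun p q =>
      (Finset.single_le_sum (fun q _ => hN p q) (Finset.mem_univ q)).trans
        (Finset.single_le_sum (f := fun p => ∑ q, N p q) (fun p _ => hN' p) (Finset.mem_univ p))
    have hsle : ∀ i, s i ≤ ∑ i, s i := fun i =>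
      Finset.single_le_sum (fun i _ => hs i) (Finset.mem_univ i)
    have h1' := hY.trace_nonneg
    have h2 : 0 ≤ ∑ p, ∑ q, N p q := Finset.sum_nonneg fun p _ => hN' p
    have h3 : 0 ≤ ∑ i, s i := Finset.sum_nonneg fun i _ => hs i
    refine ⟨⟨hY, fun p => by linarith [hd p]⟩,
      fun p _ q _ => ⟨hN p q, by show N p q ≤ 1; linarith [hNle p q]⟩,
      fun i _ => ⟨hs i, by show s i ≤ 1; linarith [hsle i]⟩, ht, by show t ≤ 1; linarith⟩

end ProductCone

/-! ### Trace pairings and symmetry of the block matrices. -/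

section Block

variable {n m : ℕ}

theorem trace_block_mul_block (s t : ℝ) (v x : Fin n → ℝ) (W X : Matrix (Fin n) (Fin n) ℝ) :
    (block s v W * block t x X).trace = s * t + 2 * (v ⬝ᵥ x) + (W * X).trace := by
  rw [block, block, Matrix.fromBlocks_multiply]
  simp [Matrix.trace,  Matrix.mul_apply, dotProduct, Finset.sum_add_distrib]
  ring

theorem block_toBlocks {Y : Matrix (Unit ⊕ Fin n) (Unit ⊕ Fin n) ℝ} (hY : Y.IsHermitian) :
    block (Y (.inl ()) (.inl ())) (fun i => Y (.inl ()) (.inr i)) Y.toBlocks₂₂ = Y := by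
  ext (p | p) (q | q)
  · rfl
  · rfl
  · simpa [block] using hY.apply (.inr p) (.inl q)
  · rfl

theorem isHermitian_block (s : ℝ) (v : Fin n → ℝ) {W : Matrix (Fin n) (Fin n) ℝ}
    (hW : W.IsHermitian) : (block s v W).IsHermitian := by
  ext (p | p) (q | q)
  · rfl
  · rfl
  · rfl
  · simpa [block] using hW.apply p q

theorem smul_block (r s : ℝ) (v : Fin n → ℝ) (W : Matrix (Fin n) (Fin n) ℝ) :
    r • block s v W = block (r * s) (r • v) (r • W) := by
  ext (p | p) (q | q) <;> rfl

variable (P : Data n m) (s : ℝ) (x : Fin n → ℝ) (X : Matrix (Fin n) (Fin n) ℝ)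

theorem trace_matA_mul_block (j : Fin m) : (P.matA j * block s x X).trace = P.a j ⬝ᵥ x := by
  simp [Data.matA, trace_block_mul_block]

theorem trace_matAhat_mul_block (j : Fin m) :
    (P.matAhat j * block s x X).trace = (Matrix.vecMulVec (P.a j) (P.a j) * X).trace := by
  simp [Data.matAhat, trace_block_mul_block]

theorem trace_matB_mul_block (i : Fin n) : (matB i * block s x X).trace = x i - X i i := by
  simp [matB, trace_block_mul_block, Matrix.trace_single_mul, sub_eq_add_neg]

theorem trace_matG_mul_block (i : Fin n) : (matG i * block s x X).trace = X i i := by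
  simp [matG, trace_block_mul_block, Matrix.trace_single_mul]

theorem trace_matH_mul_block : (matH n * block s x X).trace = s := by
  simp [matH, trace_block_mul_block]

theorem trace_matC_mul_block {P : Data n m} (hQ : P.Q.PosSemidef) :
    (P.matC * block s x X).trace = P.primalObj (x, X) := by
  have : P.Qᵀ = P.Q := by simpa using hQ.isHermitian.eq
  simp [Data.matC, Data.primalObj, trace_block_mul_block, this]
  ring

theorem isHermitian_matC {P : Data n m} (hQ : P.Q.PosSemidef) : P.matC.IsHermitian :=
  isHermitian_block _ _ hQ.isHermitian

theorem isHermitian_matA (j : Fin m) : (P.matA j).IsHermitian :=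
  isHermitian_block _ _ Matrix.isHermitian_zero

theorem isHermitian_matAhat (j : Fin m) : (P.matAhat j).IsHermitian :=
  isHermitian_block _ _ (Matrix.posSemidef_vecMulVec_self_star (P.a j)).isHermitian

theorem isHermitian_single_self {I : Type*} [DecidableEq I] (i : I) :
    (Matrix.single i i (1 : ℝ)).IsHermitian := by
  simp [Matrix.IsHermitian]

theorem isHermitian_matB (i : Fin n) : (matB i).IsHermitian :=
  isHermitian_block _ _ (isHermitian_single_self i).neg

theorem isHermitian_matG (i : Fin n) : (matG i).IsHermitian :=
  isHermitian_block _ _ (isHermitian_single_self i)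

theorem isHermitian_matH : (matH n).IsHermitian :=
  isHermitian_block _ _ Matrix.isHermitian_zero

end Block

/-! ### Compactness of the primal, attainment and weak duality. -/

namespace Data

variable {n m : ℕ} (P : Data n m) (b : Fin m → ℝ)

theorem isClosed_primalFeas : IsClosed (P.primalFeas b) := by
  have hblock : Continuous fun z : (Fin n → ℝ) × Matrix (Fin n) (Fin n) ℝ => block 1 z.1 z.2 := by
    refine continuous_matrix fun p q => ?_
    rcases p with p | p <;> rcases q with q | q <;>
      simp only [block, Matrix.fromBlocks_apply₁₁, Matrix.fromBlocks_apply₁₂,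
        Matrix.fromBlocks_apply₂₁, Matrix.fromBlocks_apply₂₂, Matrix.of_apply,
        Matrix.replicateRow_apply, Matrix.replicateCol_apply] <;> fun_prop
  have : P.primalFeas b = {z | (∀ j, P.a j ⬝ᵥ z.1 = b j) ∧
      (∀ j, (Matrix.vecMulVec (P.a j) (P.a j) * z.2).trace = b j ^ 2) ∧
      (∀ i ∈ P.B, z.1 i = z.2 i i) ∧ (∀ i ∉ P.B, z.2 i i ≤ P.U i ^ 2) ∧
      (block 1 z.1 z.2).PosSemidef ∧ ∀ p q, 0 ≤ block 1 z.1 z.2 p q} :=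
    Set.ext fun z => ⟨fun ⟨h1, h2, h3, h4, h5, h6⟩ => ⟨h1, h2, h3, h4, h5, h6⟩,
      fun ⟨h1, h2, h3, h4, h5, h6⟩ => ⟨h1, h2, h3, h4, h5, h6⟩⟩
  rw [this]
  simp only [Set.ofPred_and, Set.ofPred_forall]
  refine IsClosed.inter ?_ (IsClosed.inter ?_ (IsClosed.inter ?_ (IsClosed.inter ?_
    (IsClosed.inter (isClosed_setOf_posSemidef.preimage hblock) ?_))))
  · exact isClosed_iInter fun j => isClosed_eq (by fun_prop) continuous_const
  · exact isClosed_iInter fun j => isClosed_eq (by fun_prop) continuous_const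
  · exact isClosed_iInter fun i => isClosed_iInter fun _ => isClosed_eq (by fun_prop) (by fun_prop)
  · exact isClosed_iInter fun i => isClosed_iInter fun _ => isClosed_le (by fun_prop) (by fun_prop)
  · exact isClosed_iInter fun p => isClosed_iInter fun q => isClosed_le continuous_const
      ((continuous_apply_apply p q).comp hblock)

theorem isCompact_primalFeas : IsCompact (P.primalFeas b) := by
  set R : ℝ := 1 + ∑ i, P.U i ^ 2
  have hU : 0 ≤ ∑ i, P.U i ^ 2 := Finset.sum_nonneg fun i _ => sq_nonneg _
  have hbound : ∀ z ∈ P.primalFeas b, ∀ p q, |block 1 z.1 z.2 p q| ≤ R := by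
    intro z hz p q
    refine abs_apply_le_of_posSemidef hz.posSemidef (fun p => ?_) p q
    rcases p with p | i
    · show (1 : ℝ) ≤ R
      simpa [R] using hU
    · show z.2 i i ≤ R
      by_cases hi : i ∈ P.B
      -- The minor with the corner entry `1` gives `x_i² ≤ X_ii = x_i`, so a binary coordinate needs
      -- no explicit bound.
      · have h1 : z.1 i ^ 2 ≤ 1 * z.2 i i :=
          sq_apply_le_of_posSemidef hz.posSemidef (.inl ()) (.inr i)
        rw [← hz.binary i hi] at h1 ⊢
        have : z.1 i ≤ 1 := by nlinarith
        linarith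
      · have := Finset.single_le_sum (f := fun i => P.U i ^ 2) (fun i _ => sq_nonneg _)
          (Finset.mem_univ i)
        have := hz.bound i hi
        simp only [R]
        linarith
  have hx : IsCompact (Set.univ.pi fun _ : Fin n => Set.Icc (-R) R) :=
    isCompact_univ_pi fun _ => isCompact_Icc
  have hX : IsCompact (Set.univ.pi fun _ : Fin n => Set.univ.pi fun _ : Fin n => Set.Icc (-R) R) :=
    isCompact_univ_pi fun _ => isCompact_univ_pi fun _ => isCompact_Icc
  exact (hx.prod (Y := Matrix (Fin n) (Fin n) ℝ) hX).of_isClosed_subset (P.isClosed_primalFeas b)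
    fun z hz => ⟨fun i _ => abs_le.1 (hbound z hz (.inl ()) (.inr i)),
      fun i _ j _ => abs_le.1 (hbound z hz (.inr i) (.inr j))⟩

theorem exists_primalValue_eq (h : (P.primalFeas b).Nonempty) :
    ∃ z ∈ P.primalFeas b, P.primalValue b = (P.primalObj z : EReal) := by
  have hcont : Continuous P.primalObj := by
    unfold primalObj
    fun_prop
  obtain ⟨z, hz, hmin⟩ := (P.isCompact_primalFeas b).exists_isMinOn h hcont.continuousOn
  exact ⟨z, hz, le_antisymm (iInf₂_le z hz)
    (le_iInf₂ fun w hw => EReal.coe_le_coe_iff.2 (isMinOn_iff.1 hmin w hw))⟩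

variable {P b}

/-- Pair the dual equation with `Y` under the trace: `Θ` and `Ω` contribute nonnegative terms, and
`φ ≤ 0` turns the bounds the right way. -/
theorem dualObj_le_primalObj (hQ : P.Q.PosSemidef) {Ψ : P.DualVar} (hΨ : Ψ ∈ P.dualFeas)
    {z : (Fin n → ℝ) × Matrix (Fin n) (Fin n) ℝ} (hz : z ∈ P.primalFeas b) :
    P.dualObj Ψ b ≤ P.primalObj z := by
  obtain ⟨x, X⟩ := z
  have key := congrArg (fun M => (M * block 1 x X).trace) hΨ.eq
  simp only [sub_mul, add_mul, Finset.sum_mul, Matrix.trace_sub, Matrix.trace_add,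
    Matrix.trace_sum, Matrix.smul_mul, Matrix.trace_smul, smul_eq_mul, trace_matA_mul_block,
    trace_matAhat_mul_block, trace_matB_mul_block, trace_matG_mul_block, trace_matH_mul_block,
    trace_matC_mul_block _ _ _ hQ] at key
  have h1 : ∀ j, P.a j ⬝ᵥ x = b j := hz.linear
  have h2 : ∀ j, (Matrix.vecMulVec (P.a j) (P.a j) * X).trace = b j ^ 2 := hz.lifted
  have h3 : ∑ i : {i // i ∈ P.B}, Ψ.κ i * (x i - X i i) = 0 :=
    Finset.sum_eq_zero fun i _ => by rw [show x i = X i i from hz.binary i i.2]; ring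
  have h4 : ∑ i : {i // i ∉ P.B}, P.U i.1 ^ 2 * Ψ.φ i ≤ ∑ i : {i // i ∉ P.B}, Ψ.φ i * X i i :=
    Finset.sum_le_sum fun i _ => by
      have := mul_le_mul_of_nonpos_left (hz.bound i i.2) (hΨ.φ_nonpos i)
      linarith
  have h5 := trace_mul_nonneg_of_nonneg hΨ.Θ_nonneg hz.nonneg
  have h6 := trace_mul_nonneg_of_posSemidef hΨ.Ω_posSemidef hz.posSemidef
  simp only [h1, h2, h3] at key
  simp only at h5 h6
  rw [dualObj, Finset.sum_add_distrib]
  linarith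

theorem dualObj_le_primalValue (hQ : P.Q.PosSemidef) {Ψ : P.DualVar} (hΨ : Ψ ∈ P.dualFeas) :
    (P.dualObj Ψ b : EReal) ≤ P.primalValue b :=
  le_iInf₂ fun _ hz => EReal.coe_le_coe_iff.2 (dualObj_le_primalObj hQ hΨ hz)

end Data

/-! ### Strong duality through the conic form. -/

namespace Data

variable {n m : ℕ} (P : Data n m)

/-- Index set of the constraints of the conic form of the primal problem. The last two summands
index the objective and the equation between the semidefinite and the nonnegative copy of `Y`. -/
abbrev ConstraintIndex : Type :=
  Fin m ⊕ Fin m ⊕ {i // i ∈ P.B} ⊕ {i // i ∉ P.B} ⊕ Unit ⊕ Unit ⊕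
    ((Unit ⊕ Fin n) × (Unit ⊕ Fin n))

/-- Constraint map of the conic form of the primal problem, on tuples `(Y, N, s, t)` where `s`
are slacks of the bounds and `t` is the slack of the objective. -/
def constraintMap :
    (Matrix (Unit ⊕ Fin n) (Unit ⊕ Fin n) ℝ × Matrix (Unit ⊕ Fin n) (Unit ⊕ Fin n) ℝ ×
      ({i // i ∉ P.B} → ℝ) × ℝ) →ₗ[ℝ] (P.ConstraintIndex → ℝ) where
  toFun z := Sum.elim (fun j => (P.matA j * z.1).trace) <|
    Sum.elim (fun j => (P.matAhat j * z.1).trace) <|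
    Sum.elim (fun i => (matB i.1 * z.1).trace) <|
    Sum.elim (fun i => (matG i.1 * z.1).trace + z.2.2.1 i) <|
    Sum.elim (fun _ => (matH n * z.1).trace) <|
    Sum.elim (fun _ => (P.matC * z.1).trace + z.2.2.2) (fun p => z.1 p.1 p.2 - z.2.1 p.1 p.2)
  map_add' x y := by
    ext (i | i | i | i | i | i | i) <;> simp [Matrix.mul_add] <;> ring
  map_smul' c x := by
    ext (i | i | i | i | i | i | i) <;> simp <;> ring

/-- Right-hand side of the conic form of the primal problem with objective value `r`. -/
def constraintRHS (b : Fin m → ℝ) (r : ℝ) : P.ConstraintIndex → ℝ :=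
  Sum.elim b <| Sum.elim (fun j => b j ^ 2) <| Sum.elim 0 <| Sum.elim (fun i => P.U i.1 ^ 2) <|
    Sum.elim 1 <| Sum.elim (fun _ => r) 0

theorem continuous_constraintMap : Continuous P.constraintMap := by
  refine continuous_pi fun i => ?_
  rcases i with i | i | i | i | i | i | i <;>
    simp only [constraintMap, LinearMap.coe_mk, AddHom.coe_mk, Sum.elim_inl, Sum.elim_inr] <;>
    fun_prop

variable {P} {b : Fin m → ℝ} {r : ℝ}

theorem dotProduct_constraintMap (y : P.ConstraintIndex → ℝ)
    (Y N : Matrix (Unit ⊕ Fin n) (Unit ⊕ Fin n) ℝ) (s : {i // i ∉ P.B} → ℝ) (t : ℝ) :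
    y ⬝ᵥ P.constraintMap (Y, N, s, t) =
      ∑ j, y (.inl j) * (P.matA j * Y).trace +
      (∑ j, y (.inr (.inl j)) * (P.matAhat j * Y).trace +
      (∑ i, y (.inr (.inr (.inl i))) * (matB i.1 * Y).trace +
      (∑ i, y (.inr (.inr (.inr (.inl i)))) * ((matG i.1 * Y).trace + s i) +
      (y (.inr (.inr (.inr (.inr (.inl ()))))) * (matH n * Y).trace +
      (y (.inr (.inr (.inr (.inr (.inr (.inl ())))))) * ((P.matC * Y).trace + t) +
      ∑ p, ∑ q, y (.inr (.inr (.inr (.inr (.inr (.inr (p, q))))))) * (Y p q - N p q)))))) := by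
  simp only [dotProduct, Fintype.sum_sum_type (α₁ := Fin m),
    Fintype.sum_sum_type (α₁ := {i // i ∈ P.B}),
    Fintype.sum_sum_type (α₁ := {i // i ∉ P.B}),
    Fintype.sum_sum_type (α₁ := Unit) (α₂ := Unit ⊕ ((Unit ⊕ Fin n) × (Unit ⊕ Fin n))),
    Fintype.sum_sum_type (α₁ := Unit) (α₂ := (Unit ⊕ Fin n) × (Unit ⊕ Fin n)),
    Fintype.sum_prod_type, Finset.univ_unique, Finset.sum_singleton]
  rfl

theorem dotProduct_constraintRHS (y : P.ConstraintIndex → ℝ) :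
    y ⬝ᵥ P.constraintRHS b r =
      ∑ j, y (.inl j) * b j + (∑ j, y (.inr (.inl j)) * b j ^ 2 +
      (∑ i, y (.inr (.inr (.inr (.inl i)))) * P.U i.1 ^ 2 +
      (y (.inr (.inr (.inr (.inr (.inl ()))))) +
      y (.inr (.inr (.inr (.inr (.inr (.inl ()))))) ) * r))) := by
  simp [dotProduct, constraintRHS]

theorem eq_zero_of_constraintMap_eq_smul (hQ : P.Q.PosSemidef)
    (hr : ∀ z ∈ P.primalFeas b, r < P.primalObj z)
    {z : Matrix (Unit ⊕ Fin n) (Unit ⊕ Fin n) ℝ × Matrix (Unit ⊕ Fin n) (Unit ⊕ Fin n) ℝ ×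
      ({i // i ∉ P.B} → ℝ) × ℝ}
    (hz : z ∈ productCone (Unit ⊕ Fin n) {i // i ∉ P.B}) {l : ℝ} (hl : 0 ≤ l)
    (h : P.constraintMap z = l • P.constraintRHS b r) : z = 0 := by
  obtain ⟨Y, N, s, t⟩ := z
  obtain ⟨hY, hN, hs, ht⟩ := hz
  simp only at hY hN hs ht
  set x : Fin n → ℝ := fun i => Y (.inl ()) (.inr i) with hx
  set X : Matrix (Fin n) (Fin n) ℝ := Y.toBlocks₂₂ with hX
  have hblock : block (Y (.inl ()) (.inl ())) x X = Y := block_toBlocks hY.isHermitian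
  have hA : ∀ j, P.a j ⬝ᵥ x = l * b j := fun j => by
    rw [← trace_matA_mul_block P (Y (.inl ()) (.inl ())) x X j, hblock]
    exact congrFun h (.inl j)
  have hAhat : ∀ j, (Matrix.vecMulVec (P.a j) (P.a j) * X).trace = l * b j ^ 2 := fun j => by
    rw [← trace_matAhat_mul_block P (Y (.inl ()) (.inl ())) x X j, hblock]
    exact congrFun h (.inr (.inl j))
  have hB : ∀ i ∈ P.B, x i - X i i = 0 := fun i hi => by
    rw [← trace_matB_mul_block (Y (.inl ()) (.inl ())) x X i, hblock, ← mul_zero l]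
    exact congrFun h (.inr (.inr (.inl ⟨i, hi⟩)))
  have hG : ∀ i (hi : i ∉ P.B), X i i + s ⟨i, hi⟩ = l * P.U i ^ 2 := fun i hi => by
    rw [← trace_matG_mul_block (Y (.inl ()) (.inl ())) x X i, hblock]
    exact congrFun h (.inr (.inr (.inr (.inl ⟨i, hi⟩))))
  have hH : Y (.inl ()) (.inl ()) = l := by
    rw [← trace_matH_mul_block (Y (.inl ()) (.inl ())) x X, hblock, ← mul_one l]
    exact congrFun h (.inr (.inr (.inr (.inr (.inl ())))))
  have hC : P.primalObj (x, X) + t = l * r := by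
    rw [← trace_matC_mul_block (Y (.inl ()) (.inl ())) x X hQ, hblock]
    exact congrFun h (.inr (.inr (.inr (.inr (.inr (.inl ()))))))
  have hYN : Y = N := by
    ext p q
    have : Y p q - N p q = l * 0 := congrFun h (.inr (.inr (.inr (.inr (.inr (.inr (p, q)))))))
    linarith
  rw [hH] at hblock
  rcases hl.eq_or_lt with rfl | hl
  -- Apex case, i.e. no recession directions: a zero corner kills `x`, then the binary and bound
  -- equations kill the diagonal of `X`, so `Y` has trace zero.
  · have hx0 : x = 0 := by
      ext i
      have := sq_apply_le_of_posSemidef hY (.inl ()) (.inr i)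
      rw [hH, zero_mul] at this
      exact pow_eq_zero_iff two_ne_zero |>.1 (le_antisymm this (sq_nonneg _))
    have hdiag : ∀ i, 0 ≤ X i i := fun i => hY.diag_nonneg (i := .inr i)
    have hY0 : Y = 0 := by
      refine hY.trace_eq_zero_iff.1 ?_
      rw [Matrix.trace, Fintype.sum_sum_type]
      refine add_eq_zero_iff_of_nonneg (by simp [hH]) (Finset.sum_nonneg fun i _ => hdiag i) |>.2
        ⟨by simp [hH], Finset.sum_eq_zero fun i _ => ?_⟩
      show X i i = 0
      by_cases hi : i ∈ P.B
      · have := hB i hi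
        rw [hx0, Pi.zero_apply] at this
        linarith
      · linarith [hG i hi, hs ⟨i, hi⟩, hdiag i]
    have hX0 : X = 0 := by rw [hX, hY0]; rfl
    have hs0 : s = 0 := by
      ext ⟨i, hi⟩
      simpa [hX0] using hG i hi
    have ht0 : t = 0 := by simpa [hx0, hX0, primalObj] using hC
    rw [← hYN, hY0, hs0, ht0]
    rfl
  -- For `l > 0`, dividing by `l` gives a primal feasible point of objective at most `r`.
  · exfalso
    have hscale : block 1 (l⁻¹ • x) (l⁻¹ • X) = l⁻¹ • Y := by
      rw [← hblock, smul_block, inv_mul_cancel₀ hl.ne']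
    have hfeas : (l⁻¹ • x, l⁻¹ • X) ∈ P.primalFeas b := by
      refine ⟨fun j => ?_, fun j => ?_, fun i hi => ?_, fun i hi => ?_, ?_, fun p q => ?_⟩
      · simp [hA, hl.ne']
      · simp [hAhat, hl.ne']
      · simp [sub_eq_zero.1 (hB i hi)]
      · show l⁻¹ * X i i ≤ _
        rw [inv_mul_le_iff₀ hl]
        linarith [hG i hi, hs ⟨i, hi⟩]
      · show (block 1 (l⁻¹ • x) (l⁻¹ • X)).PosSemidef
        rw [hscale]
        exact hY.smul (inv_pos.2 hl).le
      · show 0 ≤ block 1 (l⁻¹ • x) (l⁻¹ • X) p q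
        rw [hscale, hYN]
        exact mul_nonneg (inv_pos.2 hl).le (hN p q)
    have hobj : P.primalObj (l⁻¹ • x, l⁻¹ • X) = l⁻¹ * P.primalObj (x, X) := by
      simp [primalObj, mul_add]
    have := hr _ hfeas
    rw [hobj, lt_inv_mul_iff₀ hl] at this
    linarith

variable (P) in
/-- Combination of the constraint matrices, of the objective matrix and of `S` with the given
multipliers. -/
def multiplierMatrix (γ ω : Fin m → ℝ) (κ : {i // i ∈ P.B} → ℝ) (φ : {i // i ∉ P.B} → ℝ)
    (μ ν : ℝ) (S : Matrix (Unit ⊕ Fin n) (Unit ⊕ Fin n) ℝ) :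
    Matrix (Unit ⊕ Fin n) (Unit ⊕ Fin n) ℝ :=
  ∑ j, γ j • P.matA j + (∑ j, ω j • P.matAhat j + (∑ i, κ i • matB i.1 +
    (∑ i, φ i • matG i.1 + (μ • matH n + (ν • P.matC + S)))))

theorem isHermitian_multiplierMatrix (hQ : P.Q.PosSemidef) (γ ω : Fin m → ℝ)
    (κ : {i // i ∈ P.B} → ℝ) (φ : {i // i ∉ P.B} → ℝ) (μ ν : ℝ)
    {S : Matrix (Unit ⊕ Fin n) (Unit ⊕ Fin n) ℝ} (hS : S.IsHermitian) :
    (P.multiplierMatrix γ ω κ φ μ ν S).IsHermitian := by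
  simp only [multiplierMatrix, Matrix.IsHermitian, Matrix.conjTranspose_add,
    Matrix.conjTranspose_sum, Matrix.conjTranspose_smul, star_trivial, hS.eq,
    (isHermitian_matC hQ).eq, fun j => (isHermitian_matA P j).eq,
    fun j => (isHermitian_matAhat P j).eq, fun i => (isHermitian_matB (n := n) i).eq,
    fun i => (isHermitian_matG (n := n) i).eq, (isHermitian_matH (n := n)).eq]

theorem trace_multiplierMatrix_mul (γ ω : Fin m → ℝ)
    (κ : {i // i ∈ P.B} → ℝ) (φ : {i // i ∉ P.B} → ℝ) (μ ν : ℝ)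
    (S Y : Matrix (Unit ⊕ Fin n) (Unit ⊕ Fin n) ℝ) :
    (P.multiplierMatrix γ ω κ φ μ ν S * Y).trace =
      ∑ j, γ j * (P.matA j * Y).trace + (∑ j, ω j * (P.matAhat j * Y).trace +
        (∑ i, κ i * (matB i.1 * Y).trace + (∑ i, φ i * (matG i.1 * Y).trace +
        (μ * (matH n * Y).trace + (ν * (P.matC * Y).trace + (S * Y).trace))))) := by
  simp only [multiplierMatrix, add_mul, Finset.sum_mul, Matrix.trace_add, Matrix.trace_sum,
    Matrix.smul_mul, Matrix.trace_smul, smul_eq_mul]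

/-- Homogeneous dual multipliers with a positive multiplier of the objective are dual feasible
after rescaling. -/
theorem exists_le_dualObj_of_multipliers {γ ω : Fin m → ℝ} {κ : {i // i ∈ P.B} → ℝ}
    {φ : {i // i ∉ P.B} → ℝ} {μ ν : ℝ} {S : Matrix (Unit ⊕ Fin n) (Unit ⊕ Fin n) ℝ}
    (hν : 0 < ν) (hφ : ∀ i, 0 ≤ φ i) (hS : ∀ p q, S p q ≤ 0)
    (hM : (P.multiplierMatrix γ ω κ φ μ ν S).PosSemidef)
    (hr : ∑ j, γ j * b j + (∑ j, ω j * b j ^ 2 + (∑ i, φ i * P.U i.1 ^ 2 + (μ + ν * r))) ≤ 0) :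
    ∃ Ψ ∈ P.dualFeas, r ≤ P.dualObj Ψ b := by
  -- Solve the definition of the multiplier matrix `M` for `C`: after division by `ν`, `Ω = M / ν`
  -- and `Θ = -S / ν`.
  refine ⟨⟨fun j => -(ν⁻¹ * γ j), fun j => -(ν⁻¹ * ω j), fun i => -(ν⁻¹ * φ i),
    fun i => -(ν⁻¹ * κ i), -(ν⁻¹ * μ), ν⁻¹ • P.multiplierMatrix γ ω κ φ μ ν S, -(ν⁻¹ • S)⟩,
    ⟨?_, fun i => ?_, fun p q => ?_, ?_⟩, ?_⟩
  · simp only [neg_smul, Finset.sum_neg_distrib, mul_smul, ← Finset.smul_sum, multiplierMatrix,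
      smul_add, inv_smul_smul₀ hν.ne']
    abel
  · exact neg_nonpos.2 (mul_nonneg (inv_pos.2 hν).le (hφ i))
  · exact neg_nonneg.2 (mul_nonpos_of_nonneg_of_nonpos (inv_pos.2 hν).le (hS p q))
  · exact hM.smul (inv_pos.2 hν).le
  · have hobj : P.dualObj ⟨fun j => -(ν⁻¹ * γ j), fun j => -(ν⁻¹ * ω j), fun i => -(ν⁻¹ * φ i),
        fun i => -(ν⁻¹ * κ i), -(ν⁻¹ * μ), ν⁻¹ • P.multiplierMatrix γ ω κ φ μ ν S,
        -(ν⁻¹ • S)⟩ b =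
        ν⁻¹ * -(∑ j, γ j * b j + ∑ j, ω j * b j ^ 2 + ∑ i, φ i * P.U i.1 ^ 2 + μ) := by
      simp only [dualObj, mul_neg, mul_add, Finset.mul_sum, Finset.sum_add_distrib, neg_add,
        neg_mul, Finset.sum_neg_distrib, mul_assoc, mul_comm (P.U _ ^ 2)]
      ring
    rw [hobj, le_inv_mul_iff₀ hν]
    linarith

/-- Multipliers separating the image of the cone from the right-hand side. -/
theorem exists_multipliers (hQ : P.Q.PosSemidef) (hr : ∀ z ∈ P.primalFeas b, r < P.primalObj z) :
    ∃ (γ ω : Fin m → ℝ) (κ : {i // i ∈ P.B} → ℝ) (φ : {i // i ∉ P.B} → ℝ) (μ ν : ℝ)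
      (T : Matrix (Unit ⊕ Fin n) (Unit ⊕ Fin n) ℝ),
      (∀ Y N s t, (Y, N, s, t) ∈ productCone (Unit ⊕ Fin n) {i // i ∉ P.B} →
        (Y, N, s, t) ≠ 0 →
        0 < ∑ j, γ j * (P.matA j * Y).trace + (∑ j, ω j * (P.matAhat j * Y).trace +
          (∑ i, κ i * (matB i.1 * Y).trace + (∑ i, φ i * ((matG i.1 * Y).trace + s i) +
          (μ * (matH n * Y).trace + (ν * ((P.matC * Y).trace + t) +
          ∑ p, ∑ q, T p q * (Y p q - N p q))))))) ∧
      ∑ j, γ j * b j + (∑ j, ω j * b j ^ 2 + (∑ i, φ i * P.U i.1 ^ 2 + (μ + ν * r))) ≤ 0 := by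
  obtain ⟨y, hy, hyp⟩ := exists_pos_of_cone_disjoint_ray
    (productCone (Unit ⊕ Fin n) {i // i ∉ P.B}) (productConeSum (Unit ⊕ Fin n) {i // i ∉ P.B})
    (fun z hz h0 => productConeSum_pos hz h0) isCompact_productCone_base P.constraintMap
    P.continuous_constraintMap (P.constraintRHS b r)
    (fun z hz l hl h => eq_zero_of_constraintMap_eq_smul hQ hr hz hl h)
  rw [dotProduct_constraintRHS] at hyp
  exact ⟨_, _, _, _, _, _, fun p q => y (.inr (.inr (.inr (.inr (.inr (.inr (p, q))))))),
    fun Y N s t hz h0 => (hy _ hz h0).trans_eq (dotProduct_constraintMap y Y N s t), hyp⟩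

/-- Strong duality: each strict lower bound of the primal objective is reached by the dual. -/
theorem exists_le_dualObj (hQ : P.Q.PosSemidef) (hr : ∀ z ∈ P.primalFeas b, r < P.primalObj z) :
    ∃ Ψ ∈ P.dualFeas, r ≤ P.dualObj Ψ b := by
  classical
  obtain ⟨γ, ω, κ, φ, μ, ν, T, hy, hyp⟩ := exists_multipliers hQ hr
  -- The signs of `ν`, `φ` and `T` come from testing on the generators of the `t`, `s` and `N`
  -- factors of the cone.
  have hνpos : 0 < ν := by
    have := hy 0 0 0 1 ⟨Matrix.PosSemidef.zero, by simp, by simp, by simp⟩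
      (by simp [Prod.ext_iff])
    simpa using this
  have hφnonneg : ∀ i, 0 ≤ φ i := fun i => by
    have := hy 0 0 (Pi.single i 1) 0 ⟨Matrix.PosSemidef.zero, by simp,
      fun j => by by_cases h : j = i <;> simp [h], by simp⟩
      (by simp [Prod.ext_iff])
    simpa [Pi.single_apply] using this.le
  have hTnonpos : ∀ p q, T p q ≤ 0 := fun p q => by
    have := hy 0 (Matrix.single p q 1) 0 0 ⟨Matrix.PosSemidef.zero,
      fun p' q' => by simp only [Matrix.single_apply]; split_ifs <;> simp, by simp, by simp⟩
      fun h => by simpa using congrFun (congrFun (congrArg (fun z => z.2.1) h) p) q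
    simpa [Matrix.single_apply, ite_and] using this.le
  -- `T` need not be symmetric, but `Ω` must be; symmetrizing keeps the sign and the pairing with
  -- symmetric `Y`.
  set S : Matrix (Unit ⊕ Fin n) (Unit ⊕ Fin n) ℝ := (1 / 2 : ℝ) • (T + Tᵀ) with hS
  have hSY (Y : Matrix (Unit ⊕ Fin n) (Unit ⊕ Fin n) ℝ) (hY : Y.IsHermitian) :
      (S * Y).trace = ∑ p, ∑ q, T p q * Y p q := by
    have h1 : (Tᵀ * Y).trace = ∑ p, ∑ q, T p q * Y p q := by
      rw [Matrix.trace, Finset.sum_comm]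
      rfl
    have h2 : (T * Y).trace = (Tᵀ * Y).trace := by
      rw [← Matrix.trace_transpose, Matrix.transpose_mul, Matrix.trace_mul_comm,
        show Yᵀ = Y by simpa using hY.eq]
    rw [hS, Matrix.smul_mul, Matrix.add_mul, Matrix.trace_smul, Matrix.trace_add, h2, h1,
      smul_eq_mul]
    ring
  refine exists_le_dualObj_of_multipliers (γ := γ) (ω := ω) (κ := κ) (S := S) hνpos hφnonneg
    (fun p q => mul_nonpos_of_nonneg_of_nonpos (by norm_num)
      (add_nonpos (hTnonpos p q) (hTnonpos q p)))
    (posSemidef_of_trace_mul_nonneg ?_ fun Y hY => ?_) hyp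
  · refine isHermitian_multiplierMatrix hQ γ ω κ φ μ ν ?_
    ext p q
    simp [hS, add_comm]
  · rcases eq_or_ne Y 0 with rfl | h0
    · simp
    have := (hy Y 0 0 0 ⟨hY, by simp, by simp, by simp⟩ (by simpa [Prod.ext_iff] using h0)).le
    simp only [Pi.zero_apply, Matrix.zero_apply, add_zero, sub_zero, ← hSY Y hY.isHermitian]
      at this
    rwa [trace_multiplierMatrix_mul]

/-- Every real strictly below the primal value is reached by the dual. An infeasible primal is
covered: every real qualifies and both sides are `⊤`. -/
theorem primalValue_eq_iSup_dualObj (hQ : P.Q.PosSemidef) :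
    P.primalValue b = ⨆ Ψ ∈ P.dualFeas, (P.dualObj Ψ b : EReal) := by
  refine le_antisymm (le_of_forall_lt fun c hc => ?_)
    (iSup₂_le fun _ hΨ => dualObj_le_primalValue hQ hΨ)
  obtain ⟨r, hcr, hr⟩ := EReal.lt_iff_exists_real_btwn.1 hc
  obtain ⟨Ψ, hΨ, hle⟩ := exists_le_dualObj (b := b) (r := r) hQ fun z hz =>
    EReal.coe_lt_coe_iff.1 (hr.trans_le (iInf₂_le z hz))
  exact hcr.trans_le ((EReal.coe_le_coe_iff.2 hle).trans
    (le_iSup₂ (f := fun Ψ (_ : Ψ ∈ P.dualFeas) => (P.dualObj Ψ b : EReal)) Ψ hΨ))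

end Data

/-! ### Envelope formula and the main theorem. -/

/-- Envelope formula for a function bounded below near `u` by a differentiable function which it
touches at `u`. -/
theorem ERealDifferentiableAt.gradient_eq {d : ℕ} {V : EuclideanSpace ℝ (Fin d) → EReal}
    {u : EuclideanSpace ℝ (Fin d)} (hV : ERealDifferentiableAt V u)
    {f : EuclideanSpace ℝ (Fin d) → ℝ} (hf : DifferentiableAt ℝ f u)
    (hle : ∀ w, (f w : EReal) ≤ V w) (heq : V u = f u) :
    gradient (fun w => (V w).toReal) u = gradient f u := by
  have hmin : IsLocalMin ((fun w => (V w).toReal) - f) u := by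
    -- Finiteness near `u` lets the extended-real inequality pass to `toReal`.
    filter_upwards [hV.1] with w hw
    have h1 : f w ≤ (V w).toReal :=
      EReal.coe_le_coe_iff.1 ((hle w).trans_eq (EReal.coe_toReal hw.1 hw.2).symm)
    have h2 : (V u).toReal = f u := by rw [heq, EReal.toReal_coe]
    simp only [Pi.sub_apply, h2]
    linarith
  have h0 := hmin.fderiv_eq_zero
  rw [fderiv_sub hV.2 hf, sub_eq_zero] at h0
  rw [gradient, gradient, h0]

end SDPEnvelope

end

theorem corollary1 {n m d : ℕ} (P : SDPEnvelope.Data n m) (hQ : P.Q.PosSemidef)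
    (b : Fin m → EuclideanSpace ℝ (Fin d) → ℝ) (hb : ∀ j, Differentiable ℝ (b j))
    (𝒰 : Set (EuclideanSpace ℝ (Fin d)))
    (hfeas : ∀ u ∈ 𝒰, (P.primalFeas (fun j => b j u)).Nonempty)
    (V : EuclideanSpace ℝ (Fin d) → EReal)
    (hV : V = fun u => P.primalValue (fun j => b j u))
    (fd : P.DualVar → EuclideanSpace ℝ (Fin d) → ℝ)
    (hfd : fd = fun Ψ u => P.dualObj Ψ (fun j => b j u)) :
    ∀ u ∈ 𝒰,
      -- the minimum defining `V u` is attained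
      (∃ z ∈ P.primalFeas (fun j => b j u), V u = (P.primalObj z : EReal)) ∧
      -- `V u` is the optimal value of the dual problem
      V u = (⨆ Ψ ∈ P.dualFeas, (fd Ψ u : EReal)) ∧
      ∀ Ψ ∈ P.dualOpt (fun j => b j u),
        -- given an optimal dual solution, the dual optimal value is a maximum, attained there
        (V u = (fd Ψ u : EReal) ∧
          IsGreatest ((fun Ψ' => (fd Ψ' u : EReal)) '' P.dualFeas) (V u)) ∧
        -- the envelope formula
        (SDPEnvelope.ERealDifferentiableAt V u →
          DifferentiableAt ℝ (fd Ψ) u ∧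
          gradient (fun w => (V w).toReal) u = gradient (fd Ψ) u) := by
  subst hV hfd
  intro u hu
  refine ⟨P.exists_primalValue_eq _ (hfeas u hu), SDPEnvelope.Data.primalValue_eq_iSup_dualObj hQ,
    fun Ψ ⟨hΨ, hmax⟩ => ?_⟩
  have heq : P.primalValue (fun j => b j u) = (P.dualObj Ψ (fun j => b j u) : EReal) := by
    refine le_antisymm ?_ (SDPEnvelope.Data.dualObj_le_primalValue hQ hΨ)
    rw [SDPEnvelope.Data.primalValue_eq_iSup_dualObj hQ]
    exact iSup₂_le fun Ψ' hΨ' => EReal.coe_le_coe_iff.2 (hmax Ψ' hΨ')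
  refine ⟨⟨heq, ⟨Ψ, hΨ, heq.symm⟩, ?_⟩, fun hdiff => ?_⟩
  · rintro _ ⟨Ψ', hΨ', rfl⟩
    exact SDPEnvelope.Data.dualObj_le_primalValue hQ hΨ'
  · have hf : DifferentiableAt ℝ (fun w => P.dualObj Ψ (fun j => b j w)) u := by
      have hb' : ∀ j, DifferentiableAt ℝ (b j) u := fun j => hb j u
      unfold SDPEnvelope.Data.dualObj
      fun_prop
    exact ⟨hf, hdiff.gradient_eq hf
      (fun w => SDPEnvelope.Data.dualObj_le_primalValue hQ hΨ) heq⟩
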